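/- Theorem (upper bound on the spatial outage capacity, Rayleigh link distances). Let $\alpha>2$, $\delta=2/\alpha$, $\theta>0$ and $\epsilon\in(0,1)$. For $\lambda>0$ and $p\in(0,1]$ consider the typical link of the Poisson bipolar network with ALOHA, Rayleigh fading and Rayleigh distributed link distances. That is, let $\Phi$ be a homogeneous Poisson point process on $\mathbb{R}^2$ with density $\lambda$ (the potential transmitters). Add to it a receiver at the origin and its desired, always active transmitter at distance $R$ from it, where $R$ has density $2\pi r e^{-\pi r^2}$, $r>0$ (the Rayleigh distribution with mean $1/2$). Each $z\in\Phi$ transmits with probability $p$; let $B_z\in\{0,1\}$ indicate whether it does. Let $h$ and $h_z$, $z\in\Phi$, be exponential channel power gains with mean $1$. The process $\Phi$ and all of $R$, $h$, $h_z$, $B_z$ are independent. Put $$\mathsf{SIR}=\frac{hR^{-\alpha}}{\sum_{z\in\Phi}B_z h_z\|z\|^{-\alpha}},\qquad P_{\rm s}(\theta)=\mathbb{P}\left(\mathsf{SIR}>\theta\mid\Phi,R\right),\qquad \eta_{\lambda,p}(\theta,\epsilon)=\mathbb{P}\left(P_{\rm s}(\theta)>1-\epsilon\right),$$ and let the spatial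 outage capacity be $$S(\theta,\epsilon)=\sup_{\lambda>0,\;p\in(0,1]}\lambda\,p\,\eta_{\lambda,p}(\theta,\epsilon).$$ Then, for every $b>0$, $$S(\theta,\epsilon)\le\begin{cases}\dfrac{1}{\theta^{\delta}\,\Gamma(1-\delta)\,\Gamma(1+\delta)}\cdot\dfrac{1}{b(1-\epsilon)^{b}}, & 0<b\le 1,\\[2ex] \dfrac{1}{\theta^{\delta}\,\Gamma(1-\delta)}\cdot\dfrac{\Gamma(b)}{\Gamma(b+\delta)(1-\epsilon)^{b}}, & b>1.\end{cases}$$ -/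

import Mathlib

open MeasureTheory ProbabilityTheory
open scoped ENNReal

noncomputable section

/-- The Euclidean plane. -/
abbrev Plane : Type := EuclideanSpace ℝ (Fin 2)

/-- The counting measure `∑ₙ δ_{xₙ}` of an enumerated configuration of points in the plane. -/
def countingMeasure (x : ℕ → Plane) : Measure Plane :=
  Measure.sum fun n => Measure.dirac (x n)

/-- `N` is a homogeneous Poisson point process of density `lam` in the plane: the number of points
in a measurable set of finite area is Poisson distributed with mean `lam` times the area, and the
numbers of points in pairwise disjoint such sets are independent. -/
structure IsPoissonPointProcess {Ω : Type*} [MeasurableSpace Ω] (P : Measure Ω) (lam : ℝ)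
    (N : Ω → Measure Plane) : Prop where
  measurable : Measurable N
  law_count : ∀ B : Set Plane, MeasurableSet B → volume B ≠ ∞ →
    P.map (fun ω => N ω B) =
      (poissonMeasure (ENNReal.ofReal lam * volume B).toNNReal).map (fun k : ℕ => (k : ℝ≥0∞))
  indep_count : ∀ (k : ℕ) (B : Fin k → Set Plane),
    (∀ i, MeasurableSet (B i)) → (∀ i, volume (B i) ≠ ∞) →
    Pairwise (fun i j => Disjoint (B i) (B j)) →
    iIndepFun (fun i ω => N ω (B i)) P

/-- The Rayleigh distribution with mean `1 / (2 √μ)`, i.e. with density `2 π μ r exp (-π μ r²)`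
on `(0, ∞)`. -/
def rayleighMeasure (μ : ℝ) : Measure ℝ :=
  (volume.restrict (Set.Ioi 0)).withDensity fun r =>
    ENNReal.ofReal (2 * Real.pi * μ * r * Real.exp (-(Real.pi * μ * r ^ 2)))

/-- The distribution of the activity of a node in a time slot under ALOHA: `true` (the node
transmits) with probability `p`, `false` (it stays silent) with probability `1 - p`. -/
def alohaMeasure (p : ℝ) : Measure Bool :=
  ENNReal.ofReal p • Measure.dirac true + ENNReal.ofReal (1 - p) • Measure.dirac false

/-- A Poisson bipolar network with ALOHA, Rayleigh fading and Rayleigh distributed link distances,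
as seen by its typical link. The typical link is added to the Poisson point process of
(potential) transmitters: its receiver is at the origin and its always active transmitter is at
distance `R` from it. -/
structure RayleighBipolarNetwork (μ lam p : ℝ) where
  /-- the sample space -/
  Ω : Type*
  [mΩ : MeasurableSpace Ω]
  /-- the probability measure -/
  P : Measure Ω
  [isProb : IsProbabilityMeasure P]
  /-- the locations of the potential interferers -/
  X : ℕ → Ω → Plane
  /-- the link distance of the typical link -/
  R : Ω → ℝ
  /-- the power gain of the channel of the typical link -/
  g : Ω → ℝ
  /-- the power gains of the channels from the potential interferers to the typical receiver -/
  h : ℕ → Ω → ℝ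
  /-- whether the potential interferers transmit -/
  active : ℕ → Ω → Bool
  measurable_X : ∀ n, Measurable (X n)
  measurable_R : Measurable R
  measurable_g : Measurable g
  measurable_h : ∀ n, Measurable (h n)
  measurable_active : ∀ n, Measurable (active n)
  /-- the potential transmitters form a Poisson point process of density `lam` -/
  isPoisson : IsPoissonPointProcess P lam fun ω => countingMeasure fun n => X n ω
  /-- the point process, the link distance, all the power gains and all the activities are
  independent, the link distance is Rayleigh distributed, the power gains are exponential with
  mean `1`, and each node transmits with probability `p` -/
  joint_law :
    P.map (fun ω => ((fun n => X n ω), R ω, g ω, (fun n => h n ω), (fun n => active n ω))) =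
      (P.map fun ω n => X n ω).prod
        ((rayleighMeasure μ).prod
          ((expMeasure 1).prod
            ((Measure.infinitePi fun _ : ℕ => expMeasure 1).prod
              (Measure.infinitePi fun _ : ℕ => alohaMeasure p))))

attribute [instance] RayleighBipolarNetwork.mΩ RayleighBipolarNetwork.isProb

namespace RayleighBipolarNetwork

variable {μ lam p : ℝ} (net : RayleighBipolarNetwork μ lam p)

/-- The point process of potential interferers. -/
def pointProcess (ω : net.Ω) : Measure Plane := countingMeasure fun n => net.X n ω

/-- The power received from the desired transmitter, for the path loss exponent `α`. -/
def signal (α : ℝ) (ω : net.Ω) : ℝ≥0∞ := ENNReal.ofReal (net.g ω * net.R ω ^ (-α))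

/-- The total power received from the active interferers. -/
def interference (α : ℝ) (ω : net.Ω) : ℝ≥0∞ :=
  ∑' n, if net.active n ω = true then ENNReal.ofReal (net.h n ω * ‖net.X n ω‖ ^ (-α)) else 0

/-- The signal-to-interference ratio at the typical receiver. -/
def sir (α : ℝ) (ω : net.Ω) : ℝ≥0∞ := net.signal α ω / net.interference α ω

/-- The information that is constant over time: the point process and the link distance. -/
abbrev geometry : MeasurableSpace net.Ω :=
  MeasurableSpace.comap (fun ω => (net.pointProcess ω, net.R ω)) inferInstance

/-- The conditional link success probability: the conditional probability that the
signal-to-interference ratio exceeds `θ`, given the point process and the link distance. -/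
def successProb (α θ : ℝ) : net.Ω → ℝ :=
  net.P⟦{ω | ENNReal.ofReal θ < net.sir α ω} | net.geometry⟧

/-- The meta distribution: the probability that the conditional link success probability of the
typical link exceeds `1 - ε`. -/
def metaDistribution (α θ ε : ℝ) : ℝ≥0∞ := net.P {ω | 1 - ε < net.successProb α θ ω}

end RayleighBipolarNetwork

/-- The spatial outage capacity: the supremum over the density `lam > 0` of potential transmitters
and the transmit probability `p ∈ (0, 1]` of the density of reliable links. -/
def spatialOutageCapacity {μ : ℝ}
    (net : ∀ (lam : Set.Ioi (0 : ℝ)) (p : Set.Ioc (0 : ℝ) 1), RayleighBipolarNetwork μ lam p)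
    (α θ ε : ℝ) : ℝ≥0∞ :=
  ⨆ (lam : Set.Ioi (0 : ℝ)) (p : Set.Ioc (0 : ℝ) 1),
    ENNReal.ofReal (lam * p) * (net lam p).metaDistribution α θ ε

end

/-!
Given the point process and the link distance `R`, the interferers act independently on the link
(`fadingMeasure_setOf_lt_sirOf`, `RayleighBipolarNetwork.successProb_ae_eq`): the conditional
success probability is the product over `z ∈ Φ` of the factors `u_z = p / (1 + s_z) + 1 - p`, where
`s_z = θ R^α ‖z‖^(-α)`. By Markov's inequality, the probability that it exceeds `1 - ε` is at most
its `b`-th moment divided by `(1 - ε)^b`, and the moment given `R` is the Laplace functional of the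
Poisson point process (`IsPoissonPointProcess.lintegral_expNeg_lintegral`):
`E ∏ u_z ^ b = exp (-λ ∫ (1 - u_z ^ b) dz)`.

The thinning probability `p` is pulled out of the integrand: `1 - u^b` is at least
`p b (1 - 1 / (1 + s))` for `b ≤ 1` (Bernoulli) and at least `p (1 - (1 + s)^(-b))` for `b ≥ 1`
(convexity). Both are multiples of `1 - (1 + s)^(-q)`, with `q = 1` and `q = b`. As `(1 + s)^(-q)`
is the probability that `Y > s G` for a standard exponential variable `Y` and an independent gamma
variable `G` of shape `q`, the integral of `1 - (1 + s)^(-q)` over the plane is the mean area of a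
disc of radius `R (θ G / Y)^(1/α)`, that is, `π R² θ^δ Γ(1 - δ) Γ(q + δ) / Γ(q)`
(`lintegral_one_sub_rpow_inv_one_add`). Averaging over the Rayleigh distributed `R` yields
`1 / (1 + λ p θ^δ κ)`, where `κ = a Γ(1 - δ) Γ(q + δ) / Γ(q)` with `a = b` for `b ≤ 1` and `a = 1`
for `b > 1`. The product of this with `λ p` is at most `1 / (θ^δ κ)`, uniformly in `λ` and `p`.

The computations are carried out in `[0, ∞]`: a product of factors is written as `expNeg` of the sum
of their negative logarithms `negLog`, which is an integral with respect to the point process and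
may be infinite.
-/

/-! ### The exponential function on `[0, ∞]` -/

/-- The function `t ↦ e⁻ᵗ` on `[0, ∞]`, with value `0` at `∞`. -/
noncomputable def expNeg (t : ℝ≥0∞) : ℝ≥0∞ := EReal.exp (-(t : EReal))

/-- The function `u ↦ max (-log u) 0` on `[0, ∞]`, with value `∞` at `0`. On `[0, 1]` it is the
inverse of `expNeg`. -/
noncomputable def negLog (u : ℝ≥0∞) : ℝ≥0∞ := (-ENNReal.log u).toENNReal

lemma expNeg_eq_inv (t : ℝ≥0∞) : expNeg t = (EReal.exp t)⁻¹ := EReal.exp_neg _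

lemma exp_coe_ne_zero (t : ℝ≥0∞) : EReal.exp (t : EReal) ≠ 0 := by simp

@[simp] lemma expNeg_zero : expNeg 0 = 1 := by simp [expNeg]

@[simp] lemma expNeg_top : expNeg ∞ = 0 := by simp [expNeg]

lemma expNeg_ofReal {x : ℝ} (hx : 0 ≤ x) :
    expNeg (ENNReal.ofReal x) = ENNReal.ofReal (Real.exp (-x)) := by
  rw [expNeg, EReal.coe_ennreal_ofReal, max_eq_left hx, ← EReal.coe_neg, EReal.exp_coe]

lemma expNeg_add (s t : ℝ≥0∞) : expNeg (s + t) = expNeg s * expNeg t := by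
  simp only [expNeg_eq_inv, EReal.coe_ennreal_add, EReal.exp_add]
  exact ENNReal.mul_inv (Or.inl (exp_coe_ne_zero s)) (Or.inr (exp_coe_ne_zero t))

lemma expNeg_sum {ι : Type*} (s : Finset ι) (f : ι → ℝ≥0∞) :
    expNeg (∑ i ∈ s, f i) = ∏ i ∈ s, expNeg (f i) := by
  induction s using Finset.cons_induction with
  | empty => simp
  | cons a s ha ih => rw [Finset.sum_cons, Finset.prod_cons, expNeg_add, ih]

lemma expNeg_antitone : Antitone expNeg := fun s t h => by
  simp only [expNeg_eq_inv]
  exact ENNReal.inv_le_inv.2 (EReal.exp_monotone (by exact_mod_cast h))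

lemma expNeg_le_one (t : ℝ≥0∞) : expNeg t ≤ 1 := by
  simpa using expNeg_antitone (zero_le (a := t))

lemma expNeg_ne_top (t : ℝ≥0∞) : expNeg t ≠ ∞ := ((expNeg_le_one t).trans_lt (by simp)).ne

lemma continuous_expNeg : Continuous expNeg := by
  unfold expNeg
  exact ENNReal.continuous_exp.comp (continuous_neg.comp continuous_coe_ennreal_ereal)

@[fun_prop] lemma measurable_expNeg : Measurable expNeg := continuous_expNeg.measurable

lemma expNeg_mul_ofReal (t : ℝ≥0∞) {y : ℝ} (hy : 0 ≤ y) :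
    expNeg (ENNReal.ofReal y * t) = expNeg t ^ y := by
  rw [expNeg, expNeg, ← EReal.exp_mul, EReal.coe_ennreal_mul, EReal.coe_ennreal_ofReal,
    max_eq_left hy, EReal.neg_mul, mul_comm]

lemma expNeg_natCast_mul (t : ℝ≥0∞) (n : ℕ) : expNeg (t * n) = expNeg t ^ n := by
  have := expNeg_mul_ofReal t (Nat.cast_nonneg (α := ℝ) n)
  rw [ENNReal.ofReal_natCast, ENNReal.rpow_natCast] at this
  rw [mul_comm, this]

lemma tendsto_prod_expNeg (f : ℕ → ℝ≥0∞) :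
    Filter.Tendsto (fun n => ∏ i ∈ Finset.range n, expNeg (f i)) Filter.atTop
      (nhds (expNeg (∑' i, f i))) := by
  simp_rw [← expNeg_sum]
  exact (continuous_expNeg.tendsto _).comp ENNReal.summable.hasSum.tendsto_sum_nat

lemma negLog_antitone : Antitone negLog := fun _ _ h =>
  EReal.toENNReal_le_toENNReal (EReal.neg_le_neg_iff.2 (ENNReal.log_monotone h))

lemma continuous_negLog : Continuous negLog := by
  unfold negLog
  exact EReal.continuous_toENNReal.comp (continuous_neg.comp ENNReal.continuous_log)

@[fun_prop] lemma measurable_negLog : Measurable negLog := continuous_negLog.measurable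

lemma expNeg_negLog {u : ℝ≥0∞} (hu : u ≤ 1) : expNeg (negLog u) = u := by
  have h : 0 ≤ -ENNReal.log u := by
    rw [EReal.le_neg, neg_zero]
    simpa using ENNReal.log_monotone hu
  rw [expNeg, negLog, EReal.coe_toENNReal h, neg_neg, ENNReal.exp_log]

/-! ### The Laplace functional of a Poisson point process -/

/-- The Laplace transform of the Poisson distribution. -/
lemma lintegral_expNeg_poissonMeasure (r : NNReal) (t : ℝ≥0∞) :
    ∫⁻ k : ℕ, expNeg (t * k) ∂(poissonMeasure r) = expNeg (r * (1 - expNeg t)) := by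
  obtain ⟨x, hx0, hx⟩ : ∃ x : ℝ, 0 ≤ x ∧ expNeg t = ENNReal.ofReal x :=
    ⟨(expNeg t).toReal, ENNReal.toReal_nonneg, (ENNReal.ofReal_toReal (expNeg_ne_top t)).symm⟩
  have hx1 : x ≤ 1 := by
    have := expNeg_le_one t
    rwa [hx, ENNReal.ofReal_le_one] at this
  have hr : (r : ℝ≥0∞) = ENNReal.ofReal (r : ℝ) := by simp
  have hsum := (NormedSpace.expSeries_div_hasSum_exp ((r : ℝ) * x)).mul_left (Real.exp (-r))
  rw [← Real.exp_eq_exp_ℝ, ← Real.exp_add] at hsum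
  simp_rw [expNeg_natCast_mul]
  rw [poissonMeasure, lintegral_sum_measure]
  simp_rw [lintegral_smul_measure, lintegral_dirac, smul_eq_mul, hx]
  have h1 : (1 : ℝ≥0∞) - ENNReal.ofReal x = ENNReal.ofReal (1 - x) := by
    rw [ENNReal.ofReal_sub _ hx0, ENNReal.ofReal_one]
  rw [h1, hr, ← ENNReal.ofReal_mul r.coe_nonneg,
    expNeg_ofReal (mul_nonneg r.coe_nonneg (by linarith))]
  rw [show -((r : ℝ) * (1 - x)) = -r + r * x by ring, ← hsum.tsum_eq,
    ENNReal.ofReal_tsum_of_nonneg (fun n => by have := r.2; positivity) hsum.summable]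
  refine tsum_congr fun n => ?_
  rw [← ENNReal.ofReal_pow hx0, ← ENNReal.ofReal_mul (by positivity)]
  congr 1
  rw [mul_pow]
  ring

namespace IsPoissonPointProcess

variable {Ω : Type*} [MeasurableSpace Ω] {P : Measure Ω} {lam : ℝ} {N : Ω → Measure Plane}

lemma measurable_apply (hN : IsPoissonPointProcess P lam N) {B : Set Plane}
    (hB : MeasurableSet B) : Measurable fun ω => N ω B :=
  (Measure.measurable_coe hB).comp hN.measurable

lemma lintegral_expNeg_count (hN : IsPoissonPointProcess P lam N) {B : Set Plane}
    (hB : MeasurableSet B) (hB' : volume B ≠ ∞) (t : ℝ≥0∞) :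
    ∫⁻ ω, expNeg (t * N ω B) ∂P =
      expNeg (ENNReal.ofReal lam * ((1 - expNeg t) * volume B)) := by
  have hm : Measurable fun x : ℝ≥0∞ => expNeg (t * x) := by fun_prop
  have h1 := lintegral_map (μ := P) hm (hN.measurable_apply hB)
  rw [hN.law_count B hB hB', lintegral_map hm .of_discrete, lintegral_expNeg_poissonMeasure,
    ENNReal.coe_toNNReal (ENNReal.mul_ne_top ENNReal.ofReal_ne_top hB')] at h1
  rw [← h1]
  congr 1
  ring

/-- The Laplace functional of a Poisson point process at a step function. -/
lemma lintegral_expNeg_sum (hN : IsPoissonPointProcess P lam N) {k : ℕ} {B : Fin k → Set Plane}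
    (hB : ∀ i, MeasurableSet (B i)) (hB' : ∀ i, volume (B i) ≠ ∞)
    (hd : Pairwise fun i j => Disjoint (B i) (B j)) (a : Fin k → ℝ≥0∞) :
    ∫⁻ ω, expNeg (∑ i, a i * N ω (B i)) ∂P =
      expNeg (ENNReal.ofReal lam * ∑ i, (1 - expNeg (a i)) * volume (B i)) := by
  have hm : ∀ i, Measurable fun x : ℝ≥0∞ => expNeg (a i * x) := fun i => by fun_prop
  have hind := (hN.indep_count k B hB hB' hd).comp (fun i x => expNeg (a i * x)) hm
  simp_rw [expNeg_sum, Finset.mul_sum]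
  rw [expNeg_sum]
  have := lintegral_prod_eq_prod_lintegral_of_indepFun Finset.univ _ hind
    fun i => (hm i).comp (hN.measurable_apply (hB i))
  simp only [Function.comp_apply] at this
  rw [this]
  exact Finset.prod_congr rfl fun i _ => hN.lintegral_expNeg_count (hB i) (hB' i) (a i)

/-- The preimages of the nonzero values of a simple function are disjoint, so that its integral with
respect to the point process is a sum of independent terms. -/
lemma lintegral_expNeg_simpleFunc (hN : IsPoissonPointProcess P lam N)
    (φ : SimpleFunc Plane ℝ≥0∞) (hφ : ∀ y, y ≠ 0 → volume (φ ⁻¹' {y}) ≠ ∞) :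
    ∫⁻ ω, expNeg (∫⁻ z, φ z ∂(N ω)) ∂P =
      expNeg (ENNReal.ofReal lam * ∫⁻ z, (1 - expNeg (φ z))) := by
  classical
  set s := φ.range.filter (· ≠ 0) with hs
  let e := s.equivFin
  have key : ∀ (g : ℝ≥0∞ → ℝ≥0∞) (μ : Measure Plane), g 0 = 0 →
      ∫⁻ z, g (φ z) ∂μ = ∑ i, g (e.symm i : ℝ≥0∞) * μ (φ ⁻¹' {(e.symm i : ℝ≥0∞)}) := by
    intro g μ hg
    have h1 : ∫⁻ z, g (φ z) ∂μ = ∫⁻ z, (φ.map g) z ∂μ := rfl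
    rw [h1, SimpleFunc.lintegral_eq_lintegral, SimpleFunc.map_lintegral,
      Equiv.sum_comp e.symm (fun y : s => g (y : ℝ≥0∞) * μ (φ ⁻¹' {(y : ℝ≥0∞)})),
      Finset.sum_coe_sort s (fun y => g y * μ (φ ⁻¹' {y})), hs, Finset.sum_filter_of_ne]
    rintro y - hy rfl
    exact hy (by simp [hg])
  have key1 := fun μ => key id μ rfl
  simp only [id] at key1
  simp_rw [key1]
  rw [key (fun y => 1 - expNeg y) volume (by simp)]
  refine hN.lintegral_expNeg_sum (fun i => φ.measurableSet_fiber _)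
    (fun i => hφ _ (Finset.mem_filter.1 (e.symm i).2).2) (fun i j hij => ?_) _
  refine Disjoint.preimage _ (Set.disjoint_singleton.2 fun h => hij ?_)
  exact e.symm.injective (Subtype.ext h)

/-- The Laplace functional of a Poisson point process: for every nonnegative measurable `f`,
`E exp (-∑ f(x)) = exp (-λ ∫ (1 - exp (-f)))`. -/
theorem lintegral_expNeg_lintegral [IsProbabilityMeasure P] (hN : IsPoissonPointProcess P lam N)
    {f : Plane → ℝ≥0∞} (hf : Measurable f) :
    ∫⁻ ω, expNeg (∫⁻ z, f z ∂(N ω)) ∂P =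
      expNeg (ENNReal.ofReal lam * ∫⁻ z, (1 - expNeg (f z))) := by
  -- Simple functions below `f`, cut off outside of discs, since the counts are only known in sets
  -- of finite area.
  let φ : ℕ → SimpleFunc Plane ℝ≥0∞ := fun n =>
    (SimpleFunc.eapprox f n).restrict (Metric.ball 0 n)
  have hφ_apply : ∀ n z, φ n z = (Metric.ball (0 : Plane) n).indicator (SimpleFunc.eapprox f n) z :=
    fun n z => SimpleFunc.restrict_apply _ measurableSet_ball _
  have hmono : Monotone fun n z => φ n z := fun m n hmn z => by
    simp only [hφ_apply]
    have hmn' : (m : ℝ) ≤ n := by exact_mod_cast hmn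
    refine (Set.indicator_le_indicator_of_subset
      (Metric.ball_subset_ball hmn') (fun _ => zero_le) z).trans ?_
    exact Set.indicator_le_indicator (SimpleFunc.monotone_eapprox f hmn z)
  have htend : ∀ z, Filter.Tendsto (fun n => φ n z) Filter.atTop (nhds (f z)) := fun z => by
    refine (SimpleFunc.tendsto_eapprox hf z).congr' ?_
    obtain ⟨n₀, hn₀⟩ := exists_nat_gt ‖z‖
    filter_upwards [Filter.eventually_ge_atTop n₀] with n hn
    rw [hφ_apply, Set.indicator_of_mem]
    rw [mem_ball_zero_iff]
    exact hn₀.trans_le (by exact_mod_cast hn)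
  have hstep : ∀ n, ∫⁻ ω, expNeg (∫⁻ z, φ n z ∂(N ω)) ∂P =
      expNeg (ENNReal.ofReal lam * ∫⁻ z, (1 - expNeg (φ n z))) := fun n => by
    refine hN.lintegral_expNeg_simpleFunc (φ n) fun y hy => ?_
    refine (lt_of_le_of_lt (measure_mono fun z hz => ?_)
      (measure_ball_lt_top (μ := volume) (x := (0 : Plane)) (r := n))).ne
    by_contra hz'
    refine hy ?_
    rw [← show φ n z = y from hz, hφ_apply, Set.indicator_of_notMem hz']
  have hleft : Filter.Tendsto (fun n => ∫⁻ ω, expNeg (∫⁻ z, φ n z ∂(N ω)) ∂P) Filter.atTop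
      (nhds (∫⁻ ω, expNeg (∫⁻ z, f z ∂(N ω)) ∂P)) := by
    refine tendsto_lintegral_of_dominated_convergence 1 (fun n => ?_) (fun n => ?_) (by simp) ?_
    · exact measurable_expNeg.comp
        ((Measure.measurable_lintegral (φ n).measurable).comp hN.measurable)
    · exact ae_of_all _ fun ω => expNeg_le_one _
    · refine ae_of_all _ fun ω => (continuous_expNeg.tendsto _).comp ?_
      exact lintegral_tendsto_of_tendsto_of_monotone (fun n => (φ n).measurable.aemeasurable)
        (ae_of_all _ fun z m n hmn => hmono hmn z) (ae_of_all _ htend)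
  simp_rw [hstep] at hleft
  refine tendsto_nhds_unique hleft ((continuous_expNeg.tendsto _).comp ?_)
  refine ENNReal.Tendsto.const_mul ?_ (Or.inr ENNReal.ofReal_ne_top)
  refine lintegral_tendsto_of_tendsto_of_monotone (fun n => ?_) (ae_of_all _ fun z m n hmn => ?_)
    (ae_of_all _ fun z => ?_)
  · have := (φ n).measurable
    fun_prop
  · exact tsub_le_tsub_left (expNeg_antitone (hmono hmn z)) _
  · exact ENNReal.Tendsto.sub tendsto_const_nhds ((continuous_expNeg.tendsto _).comp (htend z))
      (Or.inl ENNReal.one_ne_top)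

end IsPoissonPointProcess

/-! ### Gamma, exponential and Rayleigh integrals -/

lemma ae_pos_gammaMeasure (b : ℝ) : ∀ᵐ x ∂(gammaMeasure b 1), 0 < x := by
  rw [gammaMeasure, ae_withDensity_iff (by unfold gammaPDF; fun_prop)]
  filter_upwards [Measure.ae_ne volume (0 : ℝ)] with x hx h
  rcases lt_or_ge x 0 with h' | h'
  · exact absurd (gammaPDF_of_neg h') h
  · exact lt_of_le_of_ne h' (Ne.symm hx)

/-- The Laplace transform of the gamma distribution, weighted with a power. -/
lemma lintegral_rpow_mul_exp_gammaMeasure {b e t : ℝ} (hb : 0 < b) (he : 0 < b + e) (ht : 0 ≤ t) :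
    ∫⁻ x, ENNReal.ofReal (x ^ e * Real.exp (-(t * x))) ∂(gammaMeasure b 1) =
      ENNReal.ofReal (Real.Gamma (b + e) / Real.Gamma b * (1 + t) ^ (-(b + e))) := by
  have hΓ := Real.Gamma_pos_of_pos hb
  have hint := Real.integral_rpow_mul_exp_neg_mul_Ioi he (r := 1 + t) (by linarith)
  -- An integral with a nonzero value is that of an integrable function.
  have hne : (∫ x in Set.Ioi (0 : ℝ), x ^ (b + e - 1) * Real.exp (-((1 + t) * x))) ≠ 0 := by
    rw [hint]
    have := Real.Gamma_pos_of_pos he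
    positivity
  have hi := (not_imp_comm.1 integral_undef hne).const_mul (Real.Gamma b)⁻¹
  have h0 : (gammaPDF b 1 * fun x => ENNReal.ofReal (x ^ e * Real.exp (-(t * x)))) =ᵐ[volume]
      (Set.Ioi (0 : ℝ)).indicator fun x => ENNReal.ofReal
        ((Real.Gamma b)⁻¹ * (x ^ (b + e - 1) * Real.exp (-((1 + t) * x)))) := by
    filter_upwards [Measure.ae_ne volume (0 : ℝ)] with x hx
    rcases lt_or_gt_of_ne hx with hx | hx
    · rw [Pi.mul_apply, gammaPDF_of_neg hx, zero_mul, Set.indicator_of_notMem]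
      exact fun h => lt_asymm hx h
    · rw [Set.indicator_of_mem (show x ∈ Set.Ioi (0 : ℝ) from hx), Pi.mul_apply, gammaPDF_eq,
        if_pos hx.le, ← ENNReal.ofReal_mul (by positivity)]
      congr 1
      rw [show -((1 + t) * x) = -(1 * x) + -(t * x) by ring, Real.exp_add,
        show b + e - 1 = (b - 1) + e by ring, Real.rpow_add hx, Real.one_rpow]
      ring
  rw [gammaMeasure, lintegral_withDensity_eq_lintegral_mul _ (by unfold gammaPDF; fun_prop)
    (by fun_prop), lintegral_congr_ae h0, lintegral_indicator measurableSet_Ioi,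
    ← ofReal_integral_eq_lintegral_ofReal hi, integral_const_mul, hint]
  · congr 1
    rw [Real.rpow_neg (by linarith), one_div, Real.inv_rpow (by linarith)]
    ring
  · filter_upwards [ae_restrict_mem measurableSet_Ioi] with x hx
    have : (0 : ℝ) < x := hx
    exact mul_nonneg (inv_nonneg.2 hΓ.le) (by positivity)

lemma lintegral_expNeg_gammaMeasure {b t : ℝ} (hb : 0 < b) (ht : 0 ≤ t) :
    ∫⁻ x, expNeg (ENNReal.ofReal (t * x)) ∂(gammaMeasure b 1) =
      ENNReal.ofReal ((1 + t) ^ (-b)) := by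
  have h := lintegral_rpow_mul_exp_gammaMeasure (e := 0) hb (by simpa using hb) ht
  have hΓ := Real.Gamma_pos_of_pos hb
  rw [add_zero, div_self hΓ.ne', one_mul] at h
  rw [← h]
  refine lintegral_congr_ae ?_
  filter_upwards [ae_pos_gammaMeasure b] with x hx
  rw [expNeg_ofReal (by positivity), Real.rpow_zero, one_mul]

lemma lintegral_rpow_gammaMeasure {b e : ℝ} (hb : 0 < b) (he : 0 < b + e) :
    ∫⁻ x, ENNReal.ofReal (x ^ e) ∂(gammaMeasure b 1) =
      ENNReal.ofReal (Real.Gamma (b + e) / Real.Gamma b) := by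
  simpa using lintegral_rpow_mul_exp_gammaMeasure hb he le_rfl

lemma expMeasure_Iic {s : ℝ} (hs : 0 ≤ s) :
    expMeasure 1 (Set.Iic s) = 1 - expNeg (ENNReal.ofReal s) := by
  have := isProbabilityMeasure_expMeasure (r := 1) one_pos
  rw [← ofReal_cdf, cdf_expMeasure_eq one_pos, if_pos hs, one_mul,
    ENNReal.ofReal_sub _ (Real.exp_pos _).le, ENNReal.ofReal_one, expNeg_ofReal hs]

lemma volume_setOf_le_mul_rpow_norm {α c y : ℝ} (hα : 0 < α) (hc : 0 < c) (hy : 0 < y) :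
    volume {z : Plane | y ≤ c * ‖z‖ ^ (-α)} =
      ENNReal.ofReal (Real.pi * (c ^ (2 / α) * y ^ (-(2 / α)))) := by
  -- The centre is left out because `0 ^ (-α) = 0` for real powers in Lean.
  have hset : {z : Plane | y ≤ c * ‖z‖ ^ (-α)} =
      Metric.closedBall 0 ((c / y) ^ (1 / α)) \ {0} := by
    ext z
    rcases eq_or_ne z 0 with rfl | hz
    · simp [Real.zero_rpow (neg_ne_zero.2 hα.ne'), hy]
    · have hz' : 0 < ‖z‖ := norm_pos_iff.2 hz
      have h1 : ‖z‖ ≤ (c / y) ^ (1 / α) ↔ ‖z‖ ^ α ≤ c / y := by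
        rw [one_div, Real.le_rpow_inv_iff_of_pos hz'.le (by positivity) hα]
      simp only [Set.mem_ofPred_eq, Set.mem_sdiff, mem_closedBall_zero_iff, Set.mem_singleton_iff,
        hz, not_false_eq_true, and_true]
      rw [h1, Real.rpow_neg hz'.le, ← div_eq_mul_inv, le_div_iff₀ (by positivity),
        le_div_iff₀ hy, mul_comm]
  rw [hset, measure_sdiff_null (measure_singleton _), EuclideanSpace.volume_closedBall_fin_two]
  rw [← ENNReal.ofReal_pow (by positivity), ← NNReal.coe_real_pi,
    ENNReal.ofReal_mul (by positivity), ENNReal.ofReal_coe_nnreal, mul_comm]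
  congr 2
  rw [← Real.rpow_natCast, ← Real.rpow_mul (by positivity), Real.div_rpow hc.le hy.le,
    Real.rpow_neg hy.le, div_eq_mul_inv]
  norm_num [div_eq_mul_inv, mul_comm]

/-- `1 - exp (-s)` is the probability that a standard exponential variable is at most `s`, so that
the integral is the mean area of a disc with a random radius. -/
lemma lintegral_one_sub_expNeg_rpow_norm {α c : ℝ} (hα : 2 < α) (hc : 0 < c) :
    ∫⁻ z : Plane, (1 - expNeg (ENNReal.ofReal (c * ‖z‖ ^ (-α)))) =
      ENNReal.ofReal (Real.pi * c ^ (2 / α) * Real.Gamma (1 - 2 / α)) := by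
  have := isProbabilityMeasure_expMeasure (r := 1) one_pos
  have hm : MeasurableSet {q : Plane × ℝ | q.2 ≤ c * ‖q.1‖ ^ (-α)} :=
    measurableSet_le (by fun_prop) (by fun_prop)
  have h1 : ∀ z : Plane, 1 - expNeg (ENNReal.ofReal (c * ‖z‖ ^ (-α))) =
      expMeasure 1 (Prod.mk z ⁻¹' {q : Plane × ℝ | q.2 ≤ c * ‖q.1‖ ^ (-α)}) :=
    fun z => (expMeasure_Iic (by positivity)).symm
  have hδ : 2 / α < 1 := (div_lt_one (by linarith)).2 hα
  have h2 := lintegral_rpow_gammaMeasure (b := 1) (e := -(2 / α)) one_pos (by linarith)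
  simp_rw [h1]
  rw [← Measure.prod_apply hm, Measure.prod_apply_symm hm]
  have h3 : ∀ᵐ y ∂(expMeasure 1), volume ((fun z : Plane => (z, y)) ⁻¹'
      {q : Plane × ℝ | q.2 ≤ c * ‖q.1‖ ^ (-α)}) =
      ENNReal.ofReal (Real.pi * c ^ (2 / α)) * ENNReal.ofReal (y ^ (-(2 / α))) := by
    filter_upwards [ae_pos_gammaMeasure 1] with y hy
    rw [← ENNReal.ofReal_mul (by positivity), mul_assoc]
    exact volume_setOf_le_mul_rpow_norm (by linarith) hc hy
  rw [lintegral_congr_ae h3, lintegral_const_mul _ (by fun_prop), expMeasure, h2,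
    ← ENNReal.ofReal_mul (by positivity), Real.Gamma_one, div_one, ← sub_eq_add_neg]

/-- The power `(1 + s)⁻ᵇ` is the Laplace transform at `s` of the gamma distribution with shape `b`,
which reduces the integral to that of `1 - exp (-s x)`. -/
lemma lintegral_one_sub_rpow_inv_one_add {α b c : ℝ} (hα : 2 < α) (hb : 0 < b) (hc : 0 < c) :
    ∫⁻ z : Plane, (1 - ((1 + ENNReal.ofReal (c * ‖z‖ ^ (-α)))⁻¹) ^ b) =
      ENNReal.ofReal (Real.pi * c ^ (2 / α) *
        (Real.Gamma (1 - 2 / α) * (Real.Gamma (b + 2 / α) / Real.Gamma b))) := by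
  have := isProbabilityMeasure_gammaMeasure hb (r := 1) one_pos
  have hδ0 : 0 < 2 / α := by positivity
  have hδ : 2 / α < 1 := (div_lt_one (by linarith)).2 hα
  have hΓ := Real.Gamma_pos_of_pos (sub_pos.2 hδ)
  have h1 : ∀ z : Plane, 1 - ((1 + ENNReal.ofReal (c * ‖z‖ ^ (-α)))⁻¹) ^ b =
      ∫⁻ x, (1 - expNeg (ENNReal.ofReal (c * ‖z‖ ^ (-α) * x))) ∂(gammaMeasure b 1) := by
    intro z
    have hs : 0 ≤ c * ‖z‖ ^ (-α) := by positivity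
    generalize c * ‖z‖ ^ (-α) = s at hs ⊢
    rw [lintegral_sub (by fun_prop) ?_ (ae_of_all _ fun x => expNeg_le_one _),
      lintegral_expNeg_gammaMeasure hb hs, lintegral_one, measure_univ, ← ENNReal.ofReal_one,
      ← ENNReal.ofReal_add zero_le_one hs, ENNReal.inv_rpow,
      ENNReal.ofReal_rpow_of_pos (by positivity),
      ← ENNReal.ofReal_inv_of_pos (by positivity), Real.rpow_neg (by positivity)]
    rw [lintegral_expNeg_gammaMeasure hb hs]
    exact ENNReal.ofReal_ne_top
  simp_rw [h1]
  rw [lintegral_lintegral_swap (by fun_prop)]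
  have h2 : ∀ᵐ x ∂(gammaMeasure b 1),
      ∫⁻ z : Plane, (1 - expNeg (ENNReal.ofReal (c * ‖z‖ ^ (-α) * x))) =
      ENNReal.ofReal (Real.pi * c ^ (2 / α) * Real.Gamma (1 - 2 / α)) *
        ENNReal.ofReal (x ^ (2 / α)) := by
    filter_upwards [ae_pos_gammaMeasure b] with x hx
    simp_rw [mul_right_comm c _ x]
    rw [lintegral_one_sub_expNeg_rpow_norm hα (mul_pos hc hx), Real.mul_rpow hc.le hx.le,
      ← ENNReal.ofReal_mul (by positivity)]
    congr 1
    ring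
  rw [lintegral_congr_ae h2, lintegral_const_mul _ (by fun_prop),
    lintegral_rpow_gammaMeasure hb (by linarith), ← ENNReal.ofReal_mul (by positivity)]
  congr 1
  ring

lemma lintegral_expNeg_rayleighMeasure {K : ℝ} (hK : 0 ≤ K) :
    ∫⁻ r, expNeg (ENNReal.ofReal (K * r ^ 2)) ∂(rayleighMeasure 1) =
      ENNReal.ofReal (Real.pi / (Real.pi + K)) := by
  have hπ := Real.pi_pos
  have hpos : 0 < Real.pi + K := by linarith
  have hint : ∫ x in Set.Ioi (0 : ℝ), x * Real.exp (-((Real.pi + K) * x ^ 2)) =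
      (Real.pi + K)⁻¹ * (1 / 2) := by
    have h := integral_rpow_mul_exp_neg_mul_rpow (p := 2) (q := 1) two_pos (by norm_num) hpos
    norm_num [Real.rpow_neg_one] at h
    simp only [← neg_mul]
    simpa using h
  have hne : (∫ x in Set.Ioi (0 : ℝ), x * Real.exp (-((Real.pi + K) * x ^ 2))) ≠ 0 := by
    rw [hint]
    positivity
  have hi := (not_imp_comm.1 integral_undef hne).const_mul (2 * Real.pi)
  rw [rayleighMeasure, lintegral_withDensity_eq_lintegral_mul _ (by fun_prop) (by fun_prop)]
  have h0 : ∀ x ∈ Set.Ioi (0 : ℝ), ((fun r => ENNReal.ofReal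
      (2 * Real.pi * 1 * r * Real.exp (-(Real.pi * 1 * r ^ 2)))) *
        fun r => expNeg (ENNReal.ofReal (K * r ^ 2))) x =
      ENNReal.ofReal (2 * Real.pi * (x * Real.exp (-((Real.pi + K) * x ^ 2)))) := by
    intro x (hx : 0 < x)
    rw [Pi.mul_apply, expNeg_ofReal (by positivity), ← ENNReal.ofReal_mul (by positivity)]
    congr 1
    rw [show -((Real.pi + K) * x ^ 2) = -(Real.pi * 1 * x ^ 2) + -(K * x ^ 2) by ring,
      Real.exp_add]
    ring
  rw [setLIntegral_congr_fun measurableSet_Ioi h0, ← ofReal_integral_eq_lintegral_ofReal hi,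
    integral_const_mul, hint]
  · congr 1
    field_simp
  · filter_upwards [ae_restrict_mem measurableSet_Ioi] with x hx
    have : (0 : ℝ) < x := hx
    positivity

/-! ### Fading and activity of the interferers -/

/-- The conditional expectation of `exp (-s B h)` for an interferer that transmits with probability
`p` (`B` is its activity) and whose channel power gain `h` is a standard exponential variable. -/
noncomputable def linkFactor (p : ℝ) (s : ℝ≥0∞) : ℝ≥0∞ :=
  ENNReal.ofReal p * (1 + s)⁻¹ + ENNReal.ofReal (1 - p)

/-- The contribution of a potential interferer at `z` to the negative logarithm of the conditional
success probability of a link of length `r`. -/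
noncomputable def linkLoss (p α θ r : ℝ) (z : Plane) : ℝ≥0∞ :=
  negLog (linkFactor p (ENNReal.ofReal (θ * r ^ α * ‖z‖ ^ (-α))))

lemma linkFactor_antitone (p : ℝ) : Antitone (linkFactor p) := fun s t h => by
  unfold linkFactor
  gcongr

lemma continuous_linkFactor (p : ℝ) : Continuous (linkFactor p) := by
  unfold linkFactor
  exact ((ENNReal.continuous_const_mul ENNReal.ofReal_ne_top).comp
    (continuous_inv.comp (by fun_prop))).add continuous_const

@[fun_prop] lemma measurable_linkFactor (p : ℝ) : Measurable (linkFactor p) :=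
  (continuous_linkFactor p).measurable

lemma linkFactor_le_one {p : ℝ} (hp₀ : 0 ≤ p) (hp₁ : p ≤ 1) (s : ℝ≥0∞) : linkFactor p s ≤ 1 := by
  refine (linkFactor_antitone p (zero_le (a := s))).trans (le_of_eq ?_)
  rw [linkFactor, add_zero, inv_one, mul_one, ← ENNReal.ofReal_add hp₀ (by linarith)]
  simp

@[fun_prop] lemma measurable_linkLoss (p α θ : ℝ) :
    Measurable fun q : ℝ × Plane => linkLoss p α θ q.1 q.2 := by
  unfold linkLoss
  fun_prop

lemma expNeg_mul_linkLoss {p b : ℝ} (hp₀ : 0 ≤ p) (hp₁ : p ≤ 1) (hb : 0 ≤ b) (α θ r : ℝ)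
    (z : Plane) : expNeg (ENNReal.ofReal b * linkLoss p α θ r z) =
      linkFactor p (ENNReal.ofReal (θ * r ^ α * ‖z‖ ^ (-α))) ^ b := by
  rw [expNeg_mul_ofReal _ hb, linkLoss, expNeg_negLog (linkFactor_le_one hp₀ hp₁ _)]

lemma linkLoss_mono {p α θ r r' : ℝ} (hα : 0 ≤ α) (hθ : 0 ≤ θ) (hr : 0 ≤ r) (h : r ≤ r')
    (z : Plane) : linkLoss p α θ r z ≤ linkLoss p α θ r' z := by
  refine negLog_antitone (linkFactor_antitone p (ENNReal.ofReal_le_ofReal ?_))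
  gcongr

lemma continuous_linkLoss {α : ℝ} (hα : 0 ≤ α) (p θ : ℝ) (z : Plane) :
    Continuous fun r => linkLoss p α θ r z := by
  unfold linkLoss
  refine continuous_negLog.comp ((continuous_linkFactor p).comp (ENNReal.continuous_ofReal.comp ?_))
  have := Real.continuous_rpow_const hα
  fun_prop

/-- The loss is increasing and left continuous in the link length. -/
lemma iSup_linkLoss_rat {p α θ r : ℝ} (hα : 0 ≤ α) (hθ : 0 ≤ θ) (hr : 0 < r) (z : Plane) :
    ⨆ q : {q : ℚ // 0 < (q : ℝ) ∧ (q : ℝ) < r}, linkLoss p α θ (q : ℚ) z = linkLoss p α θ r z := by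
  refine le_antisymm (iSup_le fun q => linkLoss_mono hα hθ q.2.1.le q.2.2.le z) ?_
  refine le_of_forall_lt fun a ha => ?_
  have hev : ∀ᶠ x in nhdsWithin r (Set.Iio r), a < linkLoss p α θ x z :=
    nhdsWithin_le_nhds (((continuous_linkLoss hα p θ z).tendsto r).eventually_const_lt ha)
  obtain ⟨l, hl, hl'⟩ := (mem_nhdsLT_iff_exists_Ioo_subset' hr).1 hev
  obtain ⟨q, hq, hq'⟩ := exists_rat_btwn (max_lt hl hr)
  exact (hl' ⟨(le_max_left _ _).trans_lt hq, hq'⟩).trans_le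
    (le_iSup (fun q : {q : ℚ // 0 < (q : ℝ) ∧ (q : ℝ) < r} => linkLoss p α θ (q : ℚ) z)
      ⟨q, (le_max_right _ _).trans_lt hq, hq'⟩)

/-- The integral of the loss is jointly measurable in the configuration and the link length. The
space of all measures carries no s-finite kernel to which Tonelli's theorem could be applied;
instead, the monotonicity in the link length allows to write the integral as a countable
supremum. -/
lemma exists_measurable_lintegral_linkLoss {α θ : ℝ} (hα : 0 ≤ α) (hθ : 0 ≤ θ) (p : ℝ) :
    ∃ F : Measure Plane × ℝ → ℝ≥0∞, Measurable F ∧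
      ∀ ν r, 0 < r → F (ν, r) = ∫⁻ z, linkLoss p α θ r z ∂ν := by
  refine ⟨fun x => ⨆ q : ℚ, {r : ℝ | 0 < (q : ℝ) ∧ (q : ℝ) < r}.indicator
    (fun _ => ∫⁻ z, linkLoss p α θ q z ∂x.1) x.2, ?_, fun ν r hr => ?_⟩
  · refine Measurable.iSup fun q => ?_
    have hm : Measurable fun x : Measure Plane × ℝ => ∫⁻ z, linkLoss p α θ q z ∂x.1 :=
      (Measure.measurable_lintegral (by fun_prop)).comp measurable_fst
    refine hm.indicator (s := {x : Measure Plane × ℝ | 0 < (q : ℝ) ∧ (q : ℝ) < x.2}) ?_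
    by_cases hq : 0 < (q : ℝ)
    · simpa [hq] using measurableSet_lt measurable_const measurable_snd
    · simp [hq]
  · simp_rw [← iSup_linkLoss_rat (p := p) hα hθ hr]
    rw [lintegral_iSup_directed (fun q => by fun_prop), iSup_subtype]
    · refine iSup_congr fun q => ?_
      by_cases hq : 0 < (q : ℝ) ∧ (q : ℝ) < r
      · simp [hq]
      · rw [Set.indicator_of_notMem (s := {r : ℝ | 0 < (q : ℝ) ∧ (q : ℝ) < r}) hq]
        exact (iSup_neg hq).symm
    · refine Monotone.directed_le fun q q' h z => ?_
      exact linkLoss_mono hα hθ q.2.1.le (by exact_mod_cast h) z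

lemma lintegral_alohaMeasure (p : ℝ) (f : Bool → ℝ≥0∞) :
    ∫⁻ a, f a ∂(alohaMeasure p) = ENNReal.ofReal p * f true + ENNReal.ofReal (1 - p) * f false := by
  simp [alohaMeasure, lintegral_add_measure]

lemma isProbabilityMeasure_alohaMeasure {p : ℝ} (hp₀ : 0 ≤ p) (hp₁ : p ≤ 1) :
    IsProbabilityMeasure (alohaMeasure p) := ⟨by
  rw [← lintegral_one, lintegral_alohaMeasure, mul_one, mul_one,
    ← ENNReal.ofReal_add hp₀ (by linarith)]
  simp⟩

lemma lintegral_prod_infinitePi {S : Type*} [MeasurableSpace S] (ν : Measure S)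
    [IsProbabilityMeasure ν] (s : Finset ℕ) {f : ℕ → S → ℝ≥0∞} (hf : ∀ n, Measurable (f n)) :
    ∫⁻ x, ∏ n ∈ s, f n (x n) ∂(Measure.infinitePi fun _ : ℕ => ν) = ∏ n ∈ s, ∫⁻ a, f n a ∂ν := by
  have hind := iIndepFun_infinitePi (P := fun _ : ℕ => ν) (X := f) hf
  rw [lintegral_prod_eq_prod_lintegral_of_indepFun s _ hind
    fun n => (hf n).comp (measurable_pi_apply n)]
  refine Finset.prod_congr rfl fun n _ => ?_
  exact (measurePreserving_eval_infinitePi (fun _ : ℕ => ν) n).lintegral_comp (hf n)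

lemma expMeasure_setOf_lt_ofReal (t : ℝ≥0∞) :
    expMeasure 1 {x | t < ENNReal.ofReal x} = expNeg t := by
  have := isProbabilityMeasure_expMeasure (r := 1) one_pos
  rcases eq_or_ne t ∞ with rfl | ht
  · simp
  · obtain ⟨s, hs, rfl⟩ : ∃ s : ℝ, 0 ≤ s ∧ t = ENNReal.ofReal s :=
      ⟨t.toReal, ENNReal.toReal_nonneg, (ENNReal.ofReal_toReal ht).symm⟩
    have hset : {x : ℝ | ENNReal.ofReal s < ENNReal.ofReal x} = (Set.Iic s)ᶜ := by
      ext x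
      simp [ENNReal.ofReal_lt_ofReal_iff_of_nonneg hs]
    rw [hset, prob_compl_eq_one_sub measurableSet_Iic, expMeasure_Iic hs]
    exact ENNReal.sub_sub_cancel ENNReal.one_ne_top (expNeg_le_one _)

/-- The conditional expectation of `exp (-∑ sₙ Bₙ hₙ)` over the power gains `hₙ` and the
activities `Bₙ`. -/
lemma lintegral_expNeg_tsum_fading {p : ℝ} (hp₀ : 0 ≤ p) (hp₁ : p ≤ 1) {s : ℕ → ℝ}
    (hs : ∀ n, 0 ≤ s n) :
    ∫⁻ q : (ℕ → ℝ) × (ℕ → Bool), expNeg (∑' n, if q.2 n = true then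
        ENNReal.ofReal (s n * q.1 n) else 0)
      ∂((Measure.infinitePi fun _ : ℕ => expMeasure 1).prod
        (Measure.infinitePi fun _ : ℕ => alohaMeasure p)) =
      expNeg (∑' n, negLog (linkFactor p (ENNReal.ofReal (s n)))) := by
  have := isProbabilityMeasure_expMeasure (r := 1) one_pos
  have := isProbabilityMeasure_alohaMeasure hp₀ hp₁
  have hite : ∀ n, Measurable fun x : ℝ × Bool =>
      expNeg (if x.2 = true then ENNReal.ofReal (s n * x.1) else 0) := fun n =>
    measurable_expNeg.comp (Measurable.ite (measurable_snd (measurableSet_singleton true))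
      (by fun_prop) measurable_const)
  have hprod : ∀ k, Measurable fun q : (ℕ → ℝ) × (ℕ → Bool) => ∏ n ∈ Finset.range k,
      expNeg (if q.2 n = true then ENNReal.ofReal (s n * q.1 n) else 0) := fun k =>
    Finset.measurable_prod _ fun n _ => by
      have h1 : Measurable fun q : (ℕ → ℝ) × (ℕ → Bool) => (q.1 n, q.2 n) :=
        ((measurable_pi_apply n).comp measurable_fst).prodMk
          ((measurable_pi_apply n).comp measurable_snd)
      exact (hite n).comp h1
  have hfac : ∀ n, ∫⁻ x, ∫⁻ a, expNeg (if a = true then ENNReal.ofReal (s n * x) else 0)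
      ∂(alohaMeasure p) ∂(expMeasure 1) = linkFactor p (ENNReal.ofReal (s n)) := fun n => by
    have h1 := lintegral_expNeg_gammaMeasure one_pos (hs n)
    simp_rw [lintegral_alohaMeasure]
    simp only [if_true, Bool.false_eq_true, if_false, expNeg_zero, mul_one]
    rw [lintegral_add_right _ measurable_const, lintegral_const_mul _ (by fun_prop), expMeasure, h1,
      lintegral_const, ← expMeasure, measure_univ, mul_one, linkFactor, ← ENNReal.ofReal_one,
      ← ENNReal.ofReal_add zero_le_one (hs n), Real.rpow_neg_one,
      ENNReal.ofReal_inv_of_pos (by linarith [hs n])]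
  -- For finitely many interferers, independence factorizes the expectation.
  have hpart : ∀ k, ∫⁻ q : (ℕ → ℝ) × (ℕ → Bool), ∏ n ∈ Finset.range k,
      expNeg (if q.2 n = true then ENNReal.ofReal (s n * q.1 n) else 0)
      ∂((Measure.infinitePi fun _ : ℕ => expMeasure 1).prod
        (Measure.infinitePi fun _ : ℕ => alohaMeasure p)) =
      ∏ n ∈ Finset.range k, expNeg (negLog (linkFactor p (ENNReal.ofReal (s n)))) := fun k => by
    rw [lintegral_prod]
    · have h1 : ∀ x : ℕ → ℝ, ∫⁻ a : ℕ → Bool, ∏ n ∈ Finset.range k,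
          expNeg (if a n = true then ENNReal.ofReal (s n * x n) else 0)
          ∂(Measure.infinitePi fun _ : ℕ => alohaMeasure p) = ∏ n ∈ Finset.range k,
          ∫⁻ a, expNeg (if a = true then ENNReal.ofReal (s n * x n) else 0) ∂(alohaMeasure p) :=
        fun x => lintegral_prod_infinitePi (alohaMeasure p) (Finset.range k)
          (f := fun n a => expNeg (if a = true then ENNReal.ofReal (s n * x n) else 0))
          fun n => .of_discrete
      simp_rw [h1]
      rw [lintegral_prod_infinitePi (expMeasure 1) (Finset.range k)
        (f := fun n x => ∫⁻ a, expNeg (if a = true then ENNReal.ofReal (s n * x) else 0)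
          ∂(alohaMeasure p)) fun n => (hite n).lintegral_prod_right']
      refine Finset.prod_congr rfl fun n _ => ?_
      rw [hfac, expNeg_negLog (linkFactor_le_one hp₀ hp₁ _)]
    · exact (hprod k).aemeasurable
  refine tendsto_nhds_unique ?_ (tendsto_prod_expNeg _)
  simp_rw [← hpart]
  refine tendsto_lintegral_of_dominated_convergence 1 hprod (fun k => ?_) (by simp) ?_
  · exact ae_of_all _ fun q => Finset.prod_le_one' fun n _ => expNeg_le_one _
  · exact ae_of_all _ fun q => tendsto_prod_expNeg _

/-! ### The conditional success probability of a link -/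

/-- The signal-to-interference ratio as a function of the positions of the interferers and the link
length, and of the power gains and the activities. -/
noncomputable def sirOf (α : ℝ) (e : ((ℕ → Plane) × ℝ) × (ℝ × (ℕ → ℝ) × (ℕ → Bool))) : ℝ≥0∞ :=
  ENNReal.ofReal (e.2.1 * e.1.2 ^ (-α)) /
    ∑' n, if e.2.2.2 n = true then ENNReal.ofReal (e.2.2.1 n * ‖e.1.1 n‖ ^ (-α)) else 0

/-- The joint law of the power gains and the activities, which change from one time slot to the
next. -/
noncomputable def fadingMeasure (p : ℝ) : Measure (ℝ × (ℕ → ℝ) × (ℕ → Bool)) :=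
  (expMeasure 1).prod ((Measure.infinitePi fun _ : ℕ => expMeasure 1).prod
    (Measure.infinitePi fun _ : ℕ => alohaMeasure p))

lemma isProbabilityMeasure_fadingMeasure {p : ℝ} (hp₀ : 0 ≤ p) (hp₁ : p ≤ 1) :
    IsProbabilityMeasure (fadingMeasure p) := by
  have := isProbabilityMeasure_expMeasure (r := 1) one_pos
  have := isProbabilityMeasure_alohaMeasure hp₀ hp₁
  unfold fadingMeasure
  infer_instance

lemma measurable_sirOf (α : ℝ) : Measurable (sirOf α) := by
  unfold sirOf
  refine Measurable.div (by fun_prop) (Measurable.tsum fun n => Measurable.ite ?_ ?_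
    measurable_const)
  · have h : Measurable fun e : ((ℕ → Plane) × ℝ) × (ℝ × (ℕ → ℝ) × (ℕ → Bool)) => e.2.2.2 n :=
      (measurable_pi_apply n).comp (measurable_snd.comp (measurable_snd.comp measurable_snd))
    exact h (measurableSet_singleton true)
  · refine ENNReal.measurable_ofReal.comp (Measurable.mul ?_ (Measurable.pow_const ?_ _))
    · exact (measurable_pi_apply n).comp (measurable_fst.comp (measurable_snd.comp measurable_snd))
    · exact ((measurable_pi_apply n).comp (measurable_fst.comp measurable_fst)).norm

lemma measurable_linkLoss_right (p α θ r : ℝ) : Measurable fun z => linkLoss p α θ r z := by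
  unfold linkLoss
  fun_prop

lemma measurable_tsum_linkLoss (p α θ : ℝ) :
    Measurable fun e : (ℕ → Plane) × ℝ => ∑' n, linkLoss p α θ e.2 (e.1 n) := by
  unfold linkLoss
  fun_prop

/-- The conditional success probability of a link of length `r` among interferers at `x`. -/
lemma fadingMeasure_setOf_lt_sirOf {p α θ r : ℝ} (hp₀ : 0 ≤ p) (hp₁ : p ≤ 1) (hθ : 0 < θ)
    (hr : 0 < r) (x : ℕ → Plane) :
    fadingMeasure p {q | ENNReal.ofReal θ < sirOf α ((x, r), q)} =
      expNeg (∑' n, linkLoss p α θ r (x n)) := by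
  have := isProbabilityMeasure_expMeasure (r := 1) one_pos
  have := isProbabilityMeasure_alohaMeasure hp₀ hp₁
  have hm : MeasurableSet {q | ENNReal.ofReal θ < sirOf α ((x, r), q)} :=
    measurableSet_lt measurable_const ((measurable_sirOf α).comp measurable_prodMk_left)
  have hs : ∀ n, 0 ≤ θ * r ^ α * ‖x n‖ ^ (-α) := fun n => by positivity
  unfold fadingMeasure linkLoss
  rw [Measure.prod_apply_symm hm, ← lintegral_expNeg_tsum_fading hp₀ hp₁ hs]
  refine lintegral_congr fun q => ?_
  rw [← expMeasure_setOf_lt_ofReal]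
  congr 1
  ext g
  have hr' : r ^ (-α) * r ^ α = 1 := by rw [← Real.rpow_add hr, neg_add_cancel, Real.rpow_zero]
  have hr0 : 0 < r ^ α := by positivity
  have hrα : ENNReal.ofReal (r ^ α) ≠ 0 := by simpa using hr0
  have hθ' : ENNReal.ofReal θ ≠ 0 := by simpa using hθ
  have hsum : (∑' n, if q.2 n = true then
        ENNReal.ofReal (θ * r ^ α * ‖x n‖ ^ (-α) * q.1 n) else 0) =
      ENNReal.ofReal (r ^ α) * (ENNReal.ofReal θ * ∑' n, if q.2 n = true then
        ENNReal.ofReal (q.1 n * ‖x n‖ ^ (-α)) else 0) := by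
    rw [← mul_assoc, ← ENNReal.ofReal_mul hr0.le, ← ENNReal.tsum_mul_left]
    refine tsum_congr fun n => ?_
    split_ifs
    · rw [← ENNReal.ofReal_mul (by positivity)]
      congr 1
      ring
    · simp
  have hg : ENNReal.ofReal g = ENNReal.ofReal (r ^ α) * ENNReal.ofReal (g * r ^ (-α)) := by
    rw [← ENNReal.ofReal_mul hr0.le]
    congr 1
    rw [mul_left_comm, mul_comm (r ^ α), hr', mul_one]
  -- The threshold is positive and finite, so that this also covers an interference of `0` or `∞`.
  change ENNReal.ofReal θ < sirOf α ((x, r), (g, q)) ↔ _ < ENNReal.ofReal g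
  rw [sirOf, ENNReal.lt_div_iff_mul_lt (Or.inr ENNReal.ofReal_ne_top) (Or.inr hθ'), hsum, hg,
    ENNReal.mul_lt_mul_iff_right hrα ENNReal.ofReal_ne_top]

lemma ae_pos_rayleighMeasure (μ : ℝ) : ∀ᵐ r ∂(rayleighMeasure μ), 0 < r :=
  (withDensity_absolutelyContinuous _ _).ae_le (ae_restrict_mem measurableSet_Ioi)

instance (μ : ℝ) : SFinite (rayleighMeasure μ) := by
  unfold rayleighMeasure
  infer_instance

lemma measurable_countingMeasure : Measurable countingMeasure := by
  refine Measure.measurable_of_measurable_coe _ fun s hs => ?_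
  unfold countingMeasure
  simp_rw [Measure.sum_apply _ hs, Measure.dirac_apply' _ hs]
  exact Measurable.tsum fun n =>
    (measurable_one.indicator hs).comp (measurable_pi_apply n)

lemma lintegral_countingMeasure (x : ℕ → Plane) {f : Plane → ℝ≥0∞} (hf : Measurable f) :
    ∫⁻ z, f z ∂(countingMeasure x) = ∑' n, f (x n) := by
  rw [countingMeasure, lintegral_sum_measure]
  exact tsum_congr fun n => lintegral_dirac' _ hf

namespace RayleighBipolarNetwork

variable {μ lam p : ℝ} (net : RayleighBipolarNetwork μ lam p)

/-- The positions of the interferers and the link length. -/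
def position (ω : net.Ω) : (ℕ → Plane) × ℝ := (fun n => net.X n ω, net.R ω)

/-- The power gains and the activities. -/
def fading (ω : net.Ω) : ℝ × (ℕ → ℝ) × (ℕ → Bool) :=
  (net.g ω, fun n => net.h n ω, fun n => net.active n ω)

lemma measurable_position : Measurable net.position :=
  (measurable_pi_lambda _ net.measurable_X).prodMk net.measurable_R

lemma measurable_fading : Measurable net.fading :=
  net.measurable_g.prodMk ((measurable_pi_lambda _ net.measurable_h).prodMk
    (measurable_pi_lambda _ net.measurable_active))

lemma measurable_sir (α : ℝ) : Measurable (net.sir α) :=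
  (measurable_sirOf α).comp (net.measurable_position.prodMk net.measurable_fading)

/-- The geometry and the fading are independent, and so are the points and the link distance. -/
lemma map_position_fading (hp₀ : 0 ≤ p) (hp₁ : p ≤ 1) :
    net.P.map (fun ω => (net.position ω, net.fading ω)) =
      ((net.P.map fun ω n => net.X n ω).prod (rayleighMeasure μ)).prod (fadingMeasure p) := by
  have := isProbabilityMeasure_expMeasure (r := 1) one_pos
  have := isProbabilityMeasure_alohaMeasure hp₀ hp₁
  have hX : Measurable fun ω n => net.X n ω := measurable_pi_lambda _ net.measurable_X
  have := Measure.isProbabilityMeasure_map (μ := net.P) hX.aemeasurable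
  have := isProbabilityMeasure_fadingMeasure hp₀ hp₁
  have h := net.joint_law
  rw [← fadingMeasure, ← Measure.prodAssoc_prod] at h
  have h2 := congrArg (Measure.map MeasurableEquiv.prodAssoc.symm) h
  rw [MeasurableEquiv.map_symm_map, Measure.map_map (MeasurableEquiv.measurable _)] at h2
  · exact h2
  · exact hX.prodMk (net.measurable_R.prodMk net.measurable_fading)

lemma map_position (hp₀ : 0 ≤ p) (hp₁ : p ≤ 1) :
    net.P.map net.position = (net.P.map fun ω n => net.X n ω).prod (rayleighMeasure μ) := by
  have := isProbabilityMeasure_fadingMeasure hp₀ hp₁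
  have h := congrArg Measure.fst (net.map_position_fading hp₀ hp₁)
  rwa [Measure.fst_prod, Measure.fst_map_prodMk net.measurable_fading] at h

lemma ae_R_pos (hp₀ : 0 ≤ p) (hp₁ : p ≤ 1) : ∀ᵐ ω ∂net.P, 0 < net.R ω := by
  have h : ∀ᵐ e ∂(net.P.map net.position), 0 < e.2 := by
    rw [net.map_position hp₀ hp₁]
    exact Measure.quasiMeasurePreserving_snd.ae (ae_pos_rayleighMeasure μ)
  exact ae_of_ae_map net.measurable_position.aemeasurable h

lemma measurable_pointProcess : Measurable net.pointProcess :=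
  measurable_countingMeasure.comp (measurable_pi_lambda _ net.measurable_X)

lemma geometry_le : net.geometry ≤ net.mΩ :=
  (net.measurable_pointProcess.prodMk net.measurable_R).comap_le

/-- The joint law of the geometry and of the success event. -/
lemma measure_position_inter_sir (hp₀ : 0 ≤ p) (hp₁ : p ≤ 1) {α θ : ℝ} (hθ : 0 < θ)
    {T : Set ((ℕ → Plane) × ℝ)} (hT : MeasurableSet T) :
    net.P ({ω | ENNReal.ofReal θ < net.sir α ω} ∩ net.position ⁻¹' T) =
      ∫⁻ ω in net.position ⁻¹' T,
        expNeg (∫⁻ z, linkLoss p α θ (net.R ω) z ∂(net.pointProcess ω)) ∂net.P := by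
  have := isProbabilityMeasure_fadingMeasure hp₀ hp₁
  have hX : Measurable fun ω n => net.X n ω := measurable_pi_lambda _ net.measurable_X
  have := Measure.isProbabilityMeasure_map (μ := net.P) hX.aemeasurable
  have hm : MeasurableSet ({e | ENNReal.ofReal θ < sirOf α e} ∩ Prod.fst ⁻¹' T) :=
    (measurableSet_lt measurable_const (measurable_sirOf α)).inter (measurable_fst hT)
  have hG : Measurable fun e : (ℕ → Plane) × ℝ => expNeg (∑' n, linkLoss p α θ e.2 (e.1 n)) :=
    measurable_expNeg.comp (measurable_tsum_linkLoss p α θ)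
  have h1 := Measure.map_apply (μ := net.P)
    (net.measurable_position.prodMk net.measurable_fading) hm
  have h2 : ∀ᵐ e ∂((net.P.map fun ω n => net.X n ω).prod (rayleighMeasure μ)),
      fadingMeasure p (Prod.mk e ⁻¹' ({e | ENNReal.ofReal θ < sirOf α e} ∩ Prod.fst ⁻¹' T)) =
      T.indicator (fun e => expNeg (∑' n, linkLoss p α θ e.2 (e.1 n))) e := by
    filter_upwards [Measure.quasiMeasurePreserving_snd.ae (ae_pos_rayleighMeasure μ)] with e he
    by_cases heT : e ∈ T
    · rw [Set.indicator_of_mem heT, ← fadingMeasure_setOf_lt_sirOf hp₀ hp₁ hθ he]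
      congr 1
      ext q
      exact and_iff_left heT
    · rw [Set.indicator_of_notMem heT]
      convert measure_empty (μ := fadingMeasure p)
      ext q
      exact iff_of_false (fun h => heT h.2) (Set.notMem_empty q)
  rw [net.map_position_fading hp₀ hp₁, Measure.prod_apply hm, lintegral_congr_ae h2,
    lintegral_indicator hT, ← net.map_position hp₀ hp₁,
    setLIntegral_map hT hG net.measurable_position] at h1
  refine h1.symm.trans ?_
  refine lintegral_congr fun ω => ?_
  rw [pointProcess, lintegral_countingMeasure _ (measurable_linkLoss_right p α θ _)]
  rfl

/-- The conditional success probability is the product of the contributions of all interferers,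
which is a function of the point process and does not depend on the enumeration of its points. -/
theorem successProb_ae_eq (hp₀ : 0 ≤ p) (hp₁ : p ≤ 1) {α θ : ℝ} (hα : 0 ≤ α) (hθ : 0 < θ) :
    net.successProb α θ =ᵐ[net.P] fun ω =>
      (expNeg (∫⁻ z, linkLoss p α θ (net.R ω) z ∂(net.pointProcess ω))).toReal := by
  obtain ⟨F, hF, hF'⟩ := exists_measurable_lintegral_linkLoss hα hθ.le p
  set G : net.Ω → ℝ≥0∞ := fun ω =>
    expNeg (∫⁻ z, linkLoss p α θ (net.R ω) z ∂(net.pointProcess ω)) with hGdef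
  have hGF : (fun ω => expNeg (F (net.pointProcess ω, net.R ω))) =ᵐ[net.P] G := by
    filter_upwards [net.ae_R_pos hp₀ hp₁] with ω hω
    rw [hF' _ _ hω]
  have hA : MeasurableSet {ω | ENNReal.ofReal θ < net.sir α ω} :=
    measurableSet_lt measurable_const (net.measurable_sir α)
  have hGm : AEMeasurable G net.P := by
    refine AEMeasurable.congr (Measurable.aemeasurable ?_) hGF
    exact measurable_expNeg.comp
      (hF.comp (net.measurable_pointProcess.prodMk net.measurable_R))
  have hGint : Integrable (fun ω => (G ω).toReal) net.P := by
    refine integrable_toReal_of_lintegral_ne_top hGm (ne_of_lt ?_)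
    refine (lintegral_mono fun ω => expNeg_le_one _).trans_lt ?_
    simp
  refine (ae_eq_condExp_of_forall_setIntegral_eq net.geometry_le
    ((integrable_const (1 : ℝ)).indicator hA) (fun s _ _ => hGint.integrableOn) ?_ ?_).symm
  · rintro s ⟨T, hT, rfl⟩ -
    have hm : MeasurableSet ((fun ω => (net.pointProcess ω, net.R ω)) ⁻¹' T) :=
      (net.measurable_pointProcess.prodMk net.measurable_R) hT
    have hT' : MeasurableSet ((fun e : (ℕ → Plane) × ℝ => (countingMeasure e.1, e.2)) ⁻¹' T) :=
      ((measurable_countingMeasure.comp measurable_fst).prodMk measurable_snd) hT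
    have h := net.measure_position_inter_sir hp₀ hp₁ (α := α) hθ hT'
    rw [integral_indicator hA, setIntegral_const, smul_eq_mul, mul_one,
      integral_toReal hGm.restrict (ae_of_all _ fun ω => (expNeg_ne_top _).lt_top),
      measureReal_restrict_apply hA, measureReal_def]
    exact congrArg ENNReal.toReal h.symm
  · refine ⟨fun ω => (expNeg (F (net.pointProcess ω, net.R ω))).toReal, ?_, ?_⟩
    · refine Measurable.stronglyMeasurable ?_
      exact (ENNReal.measurable_toReal.comp (measurable_expNeg.comp hF)).comp
        (comap_measurable fun ω => (net.pointProcess ω, net.R ω))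
    · filter_upwards [hGF] with ω hω
      rw [← hω]

/-- The moments of the conditional success probability, for positive exponents. -/
lemma lintegral_expNeg_mul_lintegral_linkLoss (hp₀ : 0 ≤ p) (hp₁ : p ≤ 1) {α θ b : ℝ}
    (hb : 0 ≤ b) :
    ∫⁻ ω, expNeg (∫⁻ z, linkLoss p α θ (net.R ω) z ∂(net.pointProcess ω)) ^ b ∂net.P =
      ∫⁻ r, expNeg (ENNReal.ofReal lam * ∫⁻ z : Plane,
        (1 - linkFactor p (ENNReal.ofReal (θ * r ^ α * ‖z‖ ^ (-α))) ^ b)) ∂(rayleighMeasure μ) := by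
  have hX : Measurable fun ω n => net.X n ω := measurable_pi_lambda _ net.measurable_X
  have := Measure.isProbabilityMeasure_map (μ := net.P) hX.aemeasurable
  have hG : Measurable fun e : (ℕ → Plane) × ℝ =>
      expNeg (ENNReal.ofReal b * ∑' n, linkLoss p α θ e.2 (e.1 n)) :=
    measurable_expNeg.comp ((measurable_tsum_linkLoss p α θ).const_mul _)
  have hm : ∀ r, Measurable fun z => ENNReal.ofReal b * linkLoss p α θ r z := fun r =>
    (measurable_linkLoss_right p α θ r).const_mul _
  have h1 : ∀ ω, expNeg (∫⁻ z, linkLoss p α θ (net.R ω) z ∂(net.pointProcess ω)) ^ b =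
      expNeg (ENNReal.ofReal b *
        ∑' n, linkLoss p α θ (net.position ω).2 ((net.position ω).1 n)) := fun ω => by
    rw [← expNeg_mul_ofReal _ hb, pointProcess,
      lintegral_countingMeasure _ (measurable_linkLoss_right p α θ _)]
    rfl
  simp_rw [h1]
  rw [← lintegral_map hG net.measurable_position, net.map_position hp₀ hp₁,
    lintegral_prod_symm _ hG.aemeasurable]
  refine lintegral_congr fun r => ?_
  have h2 := net.isPoisson.lintegral_expNeg_lintegral (hm r)
  simp_rw [expNeg_mul_linkLoss hp₀ hp₁ hb] at h2
  have hGr : Measurable fun x : ℕ → Plane =>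
      expNeg (ENNReal.ofReal b * ∑' n, linkLoss p α θ r (x n)) := by
    unfold linkLoss
    fun_prop
  rw [lintegral_map hGr hX, ← h2]
  exact lintegral_congr fun ω => by
    rw [lintegral_countingMeasure _ (hm r), ENNReal.tsum_mul_left]

end RayleighBipolarNetwork

/-! ### Markov's inequality and the bound on the capacity -/

/-- Bernoulli's inequality. -/
lemma mul_le_one_sub_linkFactor_rpow_of_le_one {p b : ℝ} (hp₀ : 0 ≤ p) (hp₁ : p ≤ 1) (hb₀ : 0 ≤ b)
    (hb₁ : b ≤ 1) (s : ℝ≥0∞) :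
    ENNReal.ofReal p * (ENNReal.ofReal b * (1 - ((1 + s)⁻¹) ^ (1 : ℝ))) ≤
      1 - linkFactor p s ^ b := by
  rw [linkFactor, ENNReal.rpow_one]
  have hv1 : (1 + s)⁻¹ ≤ 1 := ENNReal.inv_le_one.2 le_self_add
  generalize (1 + s)⁻¹ = v at hv1 ⊢
  obtain ⟨w, hw, rfl⟩ : ∃ w : ℝ, 0 ≤ w ∧ v = ENNReal.ofReal w :=
    ⟨v.toReal, ENNReal.toReal_nonneg, (ENNReal.ofReal_toReal (hv1.trans_lt (by simp)).ne).symm⟩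
  rw [ENNReal.ofReal_le_one] at hv1
  have hpw : 0 ≤ p * w := mul_nonneg hp₀ hw
  rw [← ENNReal.ofReal_one, ← ENNReal.ofReal_sub _ hw, ← ENNReal.ofReal_mul hp₀,
    ← ENNReal.ofReal_add hpw (by linarith), ENNReal.ofReal_rpow_of_nonneg (by linarith) hb₀,
    ← ENNReal.ofReal_mul hb₀, ← ENNReal.ofReal_mul hp₀,
    ← ENNReal.ofReal_sub _ (Real.rpow_nonneg (by linarith) _)]
  refine ENNReal.ofReal_le_ofReal ?_
  have h := rpow_one_add_le_one_add_mul_self (s := p * w - p) (by linarith) hb₀ hb₁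
  rw [show 1 + (p * w - p) = p * w + (1 - p) by ring] at h
  linarith

/-- The function `x ↦ xᵇ` is convex and `linkFactor p s` is a convex combination of `(1 + s)⁻¹`
and `1`. -/
lemma mul_le_one_sub_linkFactor_rpow_of_one_le {p b : ℝ} (hp₀ : 0 ≤ p) (hp₁ : p ≤ 1) (hb : 1 ≤ b)
    (s : ℝ≥0∞) :
    ENNReal.ofReal p * (1 - ((1 + s)⁻¹) ^ b) ≤ 1 - linkFactor p s ^ b := by
  rw [linkFactor]
  have hv1 : (1 + s)⁻¹ ≤ 1 := ENNReal.inv_le_one.2 le_self_add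
  generalize (1 + s)⁻¹ = v at hv1 ⊢
  obtain ⟨w, hw, rfl⟩ : ∃ w : ℝ, 0 ≤ w ∧ v = ENNReal.ofReal w :=
    ⟨v.toReal, ENNReal.toReal_nonneg, (ENNReal.ofReal_toReal (hv1.trans_lt (by simp)).ne).symm⟩
  rw [ENNReal.ofReal_le_one] at hv1
  have hpw : 0 ≤ p * w := mul_nonneg hp₀ hw
  have hb₀ : 0 ≤ b := by linarith
  rw [← ENNReal.ofReal_mul hp₀, ← ENNReal.ofReal_add hpw (by linarith),
    ENNReal.ofReal_rpow_of_nonneg hw hb₀, ENNReal.ofReal_rpow_of_nonneg (by linarith) hb₀,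
    ← ENNReal.ofReal_one, ← ENNReal.ofReal_sub _ (Real.rpow_nonneg (by linarith) _),
    ← ENNReal.ofReal_sub _ (Real.rpow_nonneg (by linarith) _), ← ENNReal.ofReal_mul hp₀]
  refine ENNReal.ofReal_le_ofReal ?_
  have h := (convexOn_rpow hb).2 (Set.mem_Ici.2 hw) (Set.mem_Ici.2 zero_le_one) hp₀
    (sub_nonneg.2 hp₁) (by ring)
  simp only [smul_eq_mul, mul_one, Real.one_rpow] at h
  linarith

namespace RayleighBipolarNetwork

variable {lam p : ℝ}

/-- Markov's inequality for the `b`-th moment of the conditional success probability. -/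
lemma metaDistribution_mul_le {μ : ℝ} (net : RayleighBipolarNetwork μ lam p) (hp₀ : 0 ≤ p)
    (hp₁ : p ≤ 1) {α θ ε b : ℝ} (hα : 0 ≤ α) (hθ : 0 < θ) (hε : ε < 1) (hb : 0 < b) :
    ENNReal.ofReal ((1 - ε) ^ b) * net.metaDistribution α θ ε ≤
      ∫⁻ r, expNeg (ENNReal.ofReal lam * ∫⁻ z : Plane,
        (1 - linkFactor p (ENNReal.ofReal (θ * r ^ α * ‖z‖ ^ (-α))) ^ b)) ∂(rayleighMeasure μ) := by
  -- `F` serves only to have a measurable version of the moment in Markov's inequality.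
  obtain ⟨F, hF, hF'⟩ := exists_measurable_lintegral_linkLoss hα hθ.le p
  have hm : Measurable fun ω => expNeg (F (net.pointProcess ω, net.R ω)) ^ b :=
    (measurable_expNeg.comp
      (hF.comp (net.measurable_pointProcess.prodMk net.measurable_R))).pow_const b
  have hFae : ∀ᵐ ω ∂net.P, F (net.pointProcess ω, net.R ω) =
      ∫⁻ z, linkLoss p α θ (net.R ω) z ∂(net.pointProcess ω) := by
    filter_upwards [net.ae_R_pos hp₀ hp₁] with ω hω using hF' _ _ hω
  have hint : ∫⁻ ω, expNeg (F (net.pointProcess ω, net.R ω)) ^ b ∂net.P =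
      ∫⁻ ω, expNeg (∫⁻ z, linkLoss p α θ (net.R ω) z ∂(net.pointProcess ω)) ^ b ∂net.P :=
    lintegral_congr_ae (hFae.mono fun ω hω => by simp only [hω])
  rw [← net.lintegral_expNeg_mul_lintegral_linkLoss hp₀ hp₁ hb.le, ← hint]
  refine le_trans (mul_le_mul_right (measure_mono_ae ?_) _) (mul_meas_ge_le_lintegral hm _)
  filter_upwards [net.successProb_ae_eq hp₀ hp₁ hα hθ, hFae] with ω hω hω' (h : _ < _)
  change ENNReal.ofReal ((1 - ε) ^ b) ≤ expNeg (F (net.pointProcess ω, net.R ω)) ^ b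
  rw [hω] at h
  rw [hω', ← ENNReal.ofReal_rpow_of_nonneg (by linarith) hb.le]
  exact ENNReal.rpow_le_rpow (ENNReal.ofReal_le_of_le_toReal h.le) hb.le

/-- The bound on the density of reliable links that results from a lower bound
`p a (1 - (1 + s)^(-q))` on `1 - (linkFactor p s)ᵇ`. The number `a * Γ(1 - δ) * Γ(q + δ) / Γ(q)`
comes from integrating the former over the plane. -/
lemma mul_metaDistribution_le (net : RayleighBipolarNetwork 1 lam p) (hlam : 0 < lam)
    (hp₀ : 0 < p) (hp₁ : p ≤ 1) {α θ ε a q b : ℝ} (hα : 2 < α) (hθ : 0 < θ) (hε : ε < 1)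
    (ha : 0 < a) (hq : 0 < q) (hb : 0 < b)
    (hle : ∀ s, ENNReal.ofReal p * (ENNReal.ofReal a * (1 - ((1 + s)⁻¹) ^ q)) ≤
      1 - linkFactor p s ^ b) :
    ENNReal.ofReal (lam * p) * net.metaDistribution α θ ε ≤ ENNReal.ofReal
      (1 / (θ ^ (2 / α) * (a * (Real.Gamma (1 - 2 / α) *
        (Real.Gamma (q + 2 / α) / Real.Gamma q))) * (1 - ε) ^ b)) := by
  have hδ0 : 0 < 2 / α := by positivity
  have hδ : 2 / α < 1 := (div_lt_one (by linarith)).2 hα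
  have hΓ := Real.Gamma_pos_of_pos (sub_pos.2 hδ)
  have hΓ₁ := Real.Gamma_pos_of_pos hq
  have hΓ₂ := Real.Gamma_pos_of_pos (add_pos hq hδ0)
  have hπ := Real.pi_pos
  have hε' : 0 < (1 - ε) ^ b := Real.rpow_pos_of_pos (by linarith) b
  set κ := Real.Gamma (1 - 2 / α) * (Real.Gamma (q + 2 / α) / Real.Gamma q) with hκ
  have hκ0 : 0 < κ := by positivity
  have hθδ : 0 < θ ^ (2 / α) := by positivity
  set K := lam * p * a * Real.pi * θ ^ (2 / α) * κ with hK
  have hK0 : 0 < K := by positivity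
  have h1 := net.metaDistribution_mul_le hp₀.le hp₁ (α := α) (by linarith) hθ hε hb
  have h2 : ∫⁻ r, expNeg (ENNReal.ofReal lam * ∫⁻ z : Plane,
      (1 - linkFactor p (ENNReal.ofReal (θ * r ^ α * ‖z‖ ^ (-α))) ^ b)) ∂(rayleighMeasure 1) ≤
      ENNReal.ofReal (Real.pi / (Real.pi + K)) := by
    rw [← lintegral_expNeg_rayleighMeasure hK0.le]
    refine lintegral_mono_ae ?_
    filter_upwards [ae_pos_rayleighMeasure 1] with r hr
    refine expNeg_antitone ?_
    have h3 := lintegral_mono (μ := volume) fun z : Plane =>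
      hle (ENNReal.ofReal (θ * r ^ α * ‖z‖ ^ (-α)))
    rw [lintegral_const_mul' _ _ ENNReal.ofReal_ne_top,
      lintegral_const_mul' _ _ ENNReal.ofReal_ne_top,
      lintegral_one_sub_rpow_inv_one_add hα hq (by positivity)] at h3
    refine le_trans (le_of_eq ?_) (mul_le_mul_right h3 _)
    rw [← ENNReal.ofReal_mul ha.le, ← ENNReal.ofReal_mul hp₀.le, ← ENNReal.ofReal_mul hlam.le]
    congr 1
    rw [Real.mul_rpow hθ.le (by positivity), ← Real.rpow_mul hr.le,
      mul_div_cancel₀ _ (by linarith : α ≠ 0), Real.rpow_two, ← hκ, hK]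
    ring
  have h4 : net.metaDistribution α θ ε ≤
      ENNReal.ofReal (Real.pi / (Real.pi + K) / (1 - ε) ^ b) := by
    rw [ENNReal.ofReal_div_of_pos hε', ENNReal.le_div_iff_mul_le
      (Or.inl (by simpa using hε')) (Or.inl ENNReal.ofReal_ne_top), mul_comm]
    exact h1.trans h2
  refine (mul_le_mul_right h4 _).trans ?_
  rw [← ENNReal.ofReal_mul (by positivity)]
  refine ENNReal.ofReal_le_ofReal ?_
  -- The bound is off by the factor `K / (π + K)`, which tends to `1` as `λ p` grows.
  have h5 : lam * p * (Real.pi / (Real.pi + K) / (1 - ε) ^ b) =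
      K / (Real.pi + K) * (1 / (θ ^ (2 / α) * (a * κ) * (1 - ε) ^ b)) := by
    rw [hK]
    field_simp
  rw [h5]
  refine mul_le_of_le_one_left (by positivity) ((div_le_one (by positivity)).2 (by linarith))

end RayleighBipolarNetwork

theorem mainTheorem7
    (net : ∀ (lam : Set.Ioi (0 : ℝ)) (p : Set.Ioc (0 : ℝ) 1), RayleighBipolarNetwork 1 lam p)
    (α δ θ ε b : ℝ) (hα : 2 < α) (hδ : δ = 2 / α) (hθ : 0 < θ) (hε₀ : 0 < ε) (hε₁ : ε < 1)
    (hb : 0 < b) :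
    (b ≤ 1 →
      spatialOutageCapacity net α θ ε ≤ ENNReal.ofReal
        (1 / (θ ^ δ * Real.Gamma (1 - δ) * Real.Gamma (1 + δ)) * (1 / (b * (1 - ε) ^ b)))) ∧
    (1 < b →
      spatialOutageCapacity net α θ ε ≤ ENNReal.ofReal
        (1 / (θ ^ δ * Real.Gamma (1 - δ)) *
          (Real.Gamma b / (Real.Gamma (b + δ) * (1 - ε) ^ b)))) := by
  subst hδ
  refine ⟨fun hb₁ => iSup₂_le fun lam p => ?_, fun hb₁ => iSup₂_le fun lam p => ?_⟩
  · refine ((net lam p).mul_metaDistribution_le lam.2 p.2.1 p.2.2 hα hθ hε₁ hb one_pos hb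
      (mul_le_one_sub_linkFactor_rpow_of_le_one p.2.1.le p.2.2 hb.le hb₁)).trans (le_of_eq ?_)
    rw [Real.Gamma_one, div_one]
    congr 1
    field_simp
  · have h : ∀ s, ENNReal.ofReal p * (ENNReal.ofReal 1 * (1 - ((1 + s)⁻¹) ^ b)) ≤
        1 - linkFactor p s ^ b := fun s => by
      rw [ENNReal.ofReal_one, one_mul]
      exact mul_le_one_sub_linkFactor_rpow_of_one_le p.2.1.le p.2.2 hb₁.le s
    refine ((net lam p).mul_metaDistribution_le lam.2 p.2.1 p.2.2 hα hθ hε₁ one_pos hb hb h).trans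
      (le_of_eq ?_)
    congr 1
    field_simp
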